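/- Let $G=(V,E)$ be a finite simple undirected graph with $n$ vertices which is $(D,c)$-uniform, i.e. every vertex degree $d_v$ lies between $D$ and $cD$, where $D\ge 1$ is an integer and $c\ge 1$ is a constant. Let $\mu(v)=d_v/(2|E|)$, and let $T=T(n)$ be the $\delta$-mixing time of $G$ for $\delta=1/(2cn)^2$, i.e. the least $s$ such that the standard random walk of length $s$, from any starting vertex, has a distribution $\mu'$ with $\|\mu'-\mu\|_\infty\le\delta$ (it is assumed that such an $s$ exists). A "good start" random walk of length $t$ starts at $v$ with probability $\mu(v)$ and then performs $t$ steps of the standard random walk. For $S\subseteq E$ let $P_{\ge j,S}$ be the probability that it visits at least $j$ distinct edges of $S$. We say that $\eta\in(0,1)$ is a revisit bound for $(t,k)$ if $P_{\ge j+1,S}\le \eta P_{\ge j,S}$ for all $S\subseteq E$ with $|S|\le k$ and all $j\ge1$. Given $m$ independent "good start" walks $W_1,\dots,W_m$ of length $t$, a measurement matrix is an $m\times|E|$ matrix whose $i$-th row counts the traversals of each edge by $W_i$; alternatively, each $W_i$ is replaced by a regularized walk, i.e. any walk in $G$ that visits exactly the same edges as $W_i$, each at most twice. Its bipartite graph has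 the edges of $G$ as left nodes and the $m$ walks as right nodes, with a link for every nonzero entry. It is a $(k,\epsilon)$ expander if every set $S$ of at most $k$ left nodes has at least $(1-\epsilon)|E(S)|$ neighbours, where $E(S)$ is the set of links leaving $S$. **Theorem.** Let $c\ge1$, $0<\eta<1$ and $\varepsilon'>0$. 1. There are constants $\alpha,\kappa>0$, depending only on $c,\eta,\varepsilon'$, such that for every such $G$ and all integers $k\ge 1$, $t\ge 0$ with $kT\le\kappa D$ and $t\le\alpha|E|/k$, the number $\eta$ is a revisit bound for $(t,k)$. 2. For every $a>0$ there is a constant $\beta>0$, depending only on $a,c,\eta,\varepsilon'$, such that, with probability $1-o(1)$ as $n\to\infty$, uniformly over all such $G$ on $n$ vertices, all $k\ge1$, all $t\ge a|E|/k$ for which $\eta$ is a revisit bound for $(t,k)$, and all $m\ge \beta\,T k\log n$: the bipartite graph of the traversal-count matrix of the $m$ walks, and that of every measurement matrix obtained by regularizing the walks, is a $\left(k,\,1-\frac{1-\eta}{1+\varepsilon'}\right)$ expander. In particular, for any constant $a\in(0,\alpha]$, the conclusion of part 2 holds, with $m=\lceil\beta\,Tk\log n\rceil$ walks, whenever $a|E|/k\le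 t\le\alpha|E|/k$ and $kT\le\kappa D$. -/

import Mathlib

open MeasureTheory

/-- One-step transition matrix of the standard random walk on `G`: from `u`, move to a uniformly
chosen neighbour of `u`. -/
noncomputable def stepMatrix {V : Type*} [Fintype V] (G : SimpleGraph V) [DecidableRel G.Adj] :
    Matrix V V ℝ :=
  Matrix.of fun u v => if G.Adj u v then 1 / (G.degree u : ℝ) else 0

/-- The stationary distribution `v ↦ d_v / (2|E|)` of the standard random walk. -/
noncomputable def stationaryProb {V : Type*} [Fintype V] [DecidableEq V] (G : SimpleGraph V)
    [DecidableRel G.Adj] (v : V) : ℝ :=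
  (G.degree v : ℝ) / (2 * (G.edgeFinset.card : ℝ))

/-- `G` is a `(D, c)`-uniform graph: every degree lies between `D` and `c D`. -/
def IsUniformGraph {V : Type*} [Fintype V] (G : SimpleGraph V) [DecidableRel G.Adj]
    (D : ℕ) (c : ℝ) : Prop :=
  ∀ v, D ≤ G.degree v ∧ (G.degree v : ℝ) ≤ c * D

/-- `T` is the `δ`-mixing time of `G`: the least `s` such that the walk of length `s`, started at
any vertex, has a distribution within sup-distance `δ` of the stationary one.
(In particular such an `s` exists.) -/
def IsMixingTime {V : Type*} [Fintype V] [DecidableEq V] (G : SimpleGraph V) [DecidableRel G.Adj]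
    (δ : ℝ) (T : ℕ) : Prop :=
  IsLeast {s : ℕ | ∀ u v, |(stepMatrix G ^ s) u v - stationaryProb G v| ≤ δ} T

/-- Probability that the "good start" random walk of length `t` follows the trajectory
`w 0, w 1, …, w t`: the start is chosen proportionally to the degree, then standard steps. -/
noncomputable def trajectoryProb {V : Type*} [Fintype V] [DecidableEq V] (G : SimpleGraph V)
    [DecidableRel G.Adj] (t : ℕ) (w : Fin (t + 1) → V) : ℝ :=
  stationaryProb G (w 0) * ∏ i : Fin t, stepMatrix G (w i.castSucc) (w i.succ)

/-- Law of the "good start" random walk of length `t` on the (finite) space of trajectories. -/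
noncomputable def goodStartWalk {V : Type*} [Fintype V] [DecidableEq V] [MeasurableSpace V]
    (G : SimpleGraph V) [DecidableRel G.Adj] (t : ℕ) : Measure (Fin (t + 1) → V) :=
  ∑ w, ENNReal.ofReal (trajectoryProb G t w) • Measure.dirac w

/-- Law of `m` independent "good start" random walks of length `t`. -/
noncomputable def goodStartWalks {V : Type*} [Fintype V] [DecidableEq V] [MeasurableSpace V]
    (G : SimpleGraph V) [DecidableRel G.Adj] (t m : ℕ) : Measure (Fin m → Fin (t + 1) → V) :=
  Measure.pi fun _ => goodStartWalk G t

/-- Number of times the trajectory `w` goes through the edge `e`. -/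
def edgeVisits {V : Type*} [DecidableEq V] {t : ℕ} (w : Fin (t + 1) → V) (e : Sym2 V) : ℕ :=
  (Finset.univ.filter fun i : Fin t => s(w i.castSucc, w i.succ) = e).card

/-- Probability `P_{≥ j, S}` that a "good start" random walk of length `t` visits at least `j`
(distinct) edges of the edge set `S`. -/
noncomputable def visitProb {V : Type*} [Fintype V] [DecidableEq V] [MeasurableSpace V]
    (G : SimpleGraph V) [DecidableRel G.Adj] (t j : ℕ) (S : Finset G.edgeSet) : ℝ :=
  (goodStartWalk G t).real {w | j ≤ (S.filter fun e : G.edgeSet => edgeVisits w (e : Sym2 V) ≠ 0).card}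

/-- `η` bounds the revisit probabilities: for every edge set `S` with at most `k` edges and every
`j ≥ 1`, a walk that has visited at least `j` edges of `S` visits at least `j + 1` of them with
conditional probability at most `η`. (For `j ≥ |S|` the left side is zero.) -/
def RevisitBound {V : Type*} [Fintype V] [DecidableEq V] [MeasurableSpace V]
    (G : SimpleGraph V) [DecidableRel G.Adj] (t k : ℕ) (η : ℝ) : Prop :=
  ∀ S : Finset G.edgeSet, S.card ≤ k → ∀ j : ℕ, 1 ≤ j →
    visitProb G t (j + 1) S ≤ η * visitProb G t j S

/-- The matrix whose `(i, e)` entry is the number of times that the `i`-th walk traverses `e`. -/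
def traversalMatrix {V : Type*} [DecidableEq V] (G : SimpleGraph V) {t m : ℕ}
    (W : Fin m → Fin (t + 1) → V) : Matrix (Fin m) G.edgeSet ℕ :=
  Matrix.of fun i e => edgeVisits (W i) (e : Sym2 V)

/-- `p` is a regularized walk adapted from the trajectory `w`: it visits the same edges as `w`,
each of them at most twice. -/
def IsRegularization {V : Type*} [DecidableEq V] {G : SimpleGraph V} {t : ℕ}
    (w : Fin (t + 1) → V) {u v : V} (p : G.Walk u v) : Prop :=
  (∀ e, e ∈ p.edges ↔ edgeVisits w e ≠ 0) ∧ ∀ e, p.edges.count e ≤ 2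

/-- `A` is a measurement matrix built from the walks `W i`: row `i` counts the traversals of a
regularized walk adapted from `W i`. -/
def IsRegularizedMatrix {V : Type*} [DecidableEq V] (G : SimpleGraph V) {t m : ℕ}
    (W : Fin m → Fin (t + 1) → V) (A : Matrix (Fin m) G.edgeSet ℕ) : Prop :=
  ∀ i, ∃ (u v : V) (p : G.Walk u v), IsRegularization (W i) p ∧
    ∀ e : G.edgeSet, A i e = p.edges.count (e : Sym2 V)

open Classical in
/-- The bipartite graph of `A` (left nodes: columns, right nodes: rows, a link for each nonzero
entry) is a `(k, ε)` expander: every set `S` of at most `k` left nodes has at least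
`(1 - ε) |E(S)|` neighbours, where `E(S)` is the set of links leaving `S`. -/
def IsExpander {M E : Type*} [Fintype M] (A : Matrix M E ℕ) (k : ℕ) (ε : ℝ) : Prop :=
  ∀ S : Finset E, S.card ≤ k →
    (1 - ε) * (((Finset.univ ×ˢ S).filter fun x : M × E => A x.1 x.2 ≠ 0).card : ℝ) ≤
      ((Finset.univ.filter fun i : M => ∃ e ∈ S, A i e ≠ 0).card : ℝ)

/-!
Everything rests on one estimate, `expCross_le`: from an arbitrary starting vertex, the expected
number of steps through an edge set `S` within `t` steps is at most `|S| (T / D + 2 t / |E|)`. Before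
time `T` each step goes through `S` with probability at most `|S| / D`, because every vertex has at
least `D` neighbours; after time `T` the position is so close to stationary that this probability is
at most `2 |S| / |E|`.

*Revisit bound.* When the walk reaches its `j`-th edge of `S`, the probability that it reaches
another one is at most the expected number of further crossings of `S`, hence at most `η` when
`k T / D ≤ η / 2` and `k t / |E| ≤ η / 4`. The Markov property at that stopping time is replaced by
an induction on the number of steps which keeps track of the edges already visited
(`walkExp_revisit_le`).

*Expansion.* The same estimate for a single edge `e` shows that a walk which visits `e` does so at
most `1 + T + 2 t / |E|` times on average. As the expected number of visits from the stationary start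
is exactly `t / |E|`, the edge is visited with probability at least of order `1 / (k T)`
(`le_visit_edge`). For the number `X` of visited edges of `S` this gives `E X ≥ const * |S| / (k T)`,
and the revisit bound makes the tail of `X` geometric given `X ≥ 1`, so that
`P(X ≥ 1) ≥ (1 - η) E X` (`le_visitProb_one`). In the bipartite graph the number of links leaving `S`
is the sum of `m` independent copies of `X`, and the number of neighbours of `S` is the number of
nonzero copies. A Chernoff bound (`measure_pi_sum_gt_le`) shows that the former exceeds
`(1 + ε') / (1 - η)` times the latter with probability at most `exp (- ρ P(X ≥ 1) m)`, which is at
most `n ^ (-3 |S|)` for `m ≥ β T k log n`; the union bound over all `S` then costs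
`(1 + n ^ (-3)) ^ |E| - 1 ≤ 2 / n`. A regularized walk visits the same edges as the original one, so
regularization does not change the bipartite graph.
-/

set_option linter.unusedSectionVars false

/-! ### Expectations along the standard random walk -/

section Walk

variable {V : Type*} [Fintype V] [DecidableEq V] (G : SimpleGraph V) [DecidableRel G.Adj]

theorem stepMatrix_nonneg (u v : V) : 0 ≤ stepMatrix G u v := by
  simp only [stepMatrix, Matrix.of_apply]
  split_ifs <;> positivity

theorem stationaryProb_nonneg (v : V) : 0 ≤ stationaryProb G v := by
  unfold stationaryProb; positivity

theorem sum_stepMatrix {v : V} (hv : 0 < G.degree v) : ∑ u, stepMatrix G v u = 1 := by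
  have h : (G.degree v : ℝ) ≠ 0 := by positivity
  simp only [stepMatrix, Matrix.of_apply]
  rw [← Finset.sum_filter, Finset.sum_const, ← SimpleGraph.neighborFinset_eq_filter,
    SimpleGraph.card_neighborFinset_eq_degree, nsmul_eq_mul]
  field_simp

/-- Under the stationary law, each oriented edge is traversed in one step with the same
probability. -/
theorem stationaryProb_mul_stepMatrix (u v : V) :
    stationaryProb G u * stepMatrix G u v =
      if G.Adj u v then 1 / (2 * (G.edgeFinset.card : ℝ)) else 0 := by
  simp only [stepMatrix, Matrix.of_apply, stationaryProb]
  split_ifs with h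
  · have : 0 < G.degree u := (G.degree_pos_iff_exists_adj u).2 ⟨v, h⟩
    field_simp
  · simp

/-- The law proportional to the degree is stationary. -/
theorem sum_stationaryProb_mul_stepMatrix (v : V) :
    ∑ u, stationaryProb G u * stepMatrix G u v = stationaryProb G v := by
  simp only [stationaryProb_mul_stepMatrix, G.adj_comm _ v]
  rw [← Finset.sum_filter, Finset.sum_const, ← SimpleGraph.neighborFinset_eq_filter,
    SimpleGraph.card_neighborFinset_eq_degree, nsmul_eq_mul, stationaryProb]
  ring

theorem sum_stationaryProb (hE : 0 < G.edgeFinset.card) : ∑ v, stationaryProb G v = 1 := by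
  simp only [stationaryProb]
  rw [← Finset.sum_div, ← Nat.cast_sum, G.sum_degrees_eq_twice_card_edges]
  push_cast
  field_simp

/-- Expectation of the functional `F` of the trajectory of the standard random walk of length `t`
started at the vertex `v`. -/
noncomputable def walkExp (t : ℕ) (v : V) (F : (Fin (t + 1) → V) → ℝ) : ℝ :=
  ∑ w : Fin t → V,
    (∏ i : Fin t, stepMatrix G ((Fin.cons v w : Fin (t + 1) → V) i.castSucc)
      ((Fin.cons v w : Fin (t + 1) → V) i.succ)) * F (Fin.cons v w)

variable {G}

theorem walkExp_zero (v : V) (F : (Fin 1 → V) → ℝ) : walkExp G 0 v F = F fun _ => v := by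
  simp only [walkExp, Finset.univ_unique, Finset.sum_singleton, Finset.univ_eq_empty,
    Finset.prod_empty, one_mul]
  congr 1
  ext i
  fin_cases i
  rfl

/-- The Markov property at the first step. -/
theorem walkExp_succ (t : ℕ) (v : V) (F : (Fin (t + 2) → V) → ℝ) :
    walkExp G (t + 1) v F =
      ∑ u, stepMatrix G v u * walkExp G t u (fun w => F (Fin.cons v w)) := by
  unfold walkExp
  rw [← (Fin.consEquiv (fun _ : Fin (t + 1) => V)).sum_comp, Fintype.sum_prod_type]
  refine Finset.sum_congr rfl fun u _ => ?_
  rw [Finset.mul_sum]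
  refine Finset.sum_congr rfl fun w _ => ?_
  rw [Fin.prod_univ_succ, ← mul_assoc]
  rfl

theorem walkExp_mono {t : ℕ} {v : V} {F F' : (Fin (t + 1) → V) → ℝ}
    (h : ∀ w, w 0 = v → F w ≤ F' w) : walkExp G t v F ≤ walkExp G t v F' :=
  Finset.sum_le_sum fun w _ => mul_le_mul_of_nonneg_left (h (Fin.cons v w) rfl)
    (Finset.prod_nonneg fun _ _ => stepMatrix_nonneg G _ _)

theorem walkExp_congr {t : ℕ} {v : V} {F F' : (Fin (t + 1) → V) → ℝ}
    (h : ∀ w, w 0 = v → F w = F' w) : walkExp G t v F = walkExp G t v F' :=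
  Finset.sum_congr rfl fun w _ => by rw [h _ rfl]

theorem walkExp_add (t : ℕ) (v : V) (F F' : (Fin (t + 1) → V) → ℝ) :
    walkExp G t v (fun w => F w + F' w) = walkExp G t v F + walkExp G t v F' := by
  simp only [walkExp, mul_add, Finset.sum_add_distrib]

theorem walkExp_const (hdeg : ∀ v, 0 < G.degree v) (a : ℝ) (t : ℕ) (v : V) :
    walkExp G t v (fun _ => a) = a := by
  induction t generalizing v with
  | zero => rw [walkExp_zero]
  | succ t ih => simp only [walkExp_succ, ih, ← Finset.sum_mul, sum_stepMatrix G (hdeg v), one_mul]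

theorem sum_trajectoryProb_mul (t : ℕ) (F : (Fin (t + 1) → V) → ℝ) :
    ∑ w, trajectoryProb G t w * F w = ∑ v, stationaryProb G v * walkExp G t v F := by
  rw [← (Fin.consEquiv (fun _ : Fin (t + 1) => V)).sum_comp, Fintype.sum_prod_type]
  refine Finset.sum_congr rfl fun u _ => ?_
  rw [walkExp, Finset.mul_sum]
  refine Finset.sum_congr rfl fun w _ => ?_
  rw [← mul_assoc]
  rfl

theorem trajectoryProb_nonneg (t : ℕ) (w : Fin (t + 1) → V) : 0 ≤ trajectoryProb G t w :=
  mul_nonneg (stationaryProb_nonneg G _) (Finset.prod_nonneg fun _ _ => stepMatrix_nonneg G _ _)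

theorem isProbabilityMeasure_goodStartWalk [MeasurableSpace V] (hdeg : ∀ v, 0 < G.degree v)
    (hE : 0 < G.edgeFinset.card) (t : ℕ) : IsProbabilityMeasure (goodStartWalk G t) := by
  constructor
  have h := sum_trajectoryProb_mul (G := G) t (fun _ => 1)
  simp only [walkExp_const hdeg, mul_one, sum_stationaryProb G hE] at h
  simp only [goodStartWalk, Measure.coe_finsetSum, Finset.sum_apply, Measure.smul_apply,
    measure_univ, smul_eq_mul, mul_one]
  rw [← ENNReal.ofReal_sum_of_nonneg fun w _ => trajectoryProb_nonneg t w, h, ENNReal.ofReal_one]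

theorem integral_goodStartWalk [MeasurableSpace V] [MeasurableSingletonClass V] (t : ℕ)
    (F : (Fin (t + 1) → V) → ℝ) :
    ∫ w, F w ∂goodStartWalk G t = ∑ v, stationaryProb G v * walkExp G t v F := by
  rw [← sum_trajectoryProb_mul, goodStartWalk, integral_finsetSum_measure]
  · refine Finset.sum_congr rfl fun w _ => ?_
    rw [integral_smul_measure, integral_dirac, ENNReal.toReal_ofReal (trajectoryProb_nonneg t w),
      smul_eq_mul]
  · exact fun w _ => (integrable_dirac (by simp)).smul_measure ENNReal.ofReal_ne_top

theorem goodStartWalk_real [MeasurableSpace V] [MeasurableSingletonClass V] (t : ℕ)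
    (p : (Fin (t + 1) → V) → Prop) [DecidablePred p] :
    (goodStartWalk G t).real {w | p w} =
      ∑ v, stationaryProb G v * walkExp G t v (fun w => if p w then 1 else 0) := by
  rw [← integral_goodStartWalk, ← integral_indicator_one (Set.toFinite _).measurableSet]
  congr 1
  ext w
  simp [Set.indicator_apply]

theorem edgeVisits_cons {t : ℕ} (v : V) (w : Fin (t + 1) → V) (e : Sym2 V) :
    edgeVisits (Fin.cons v w : Fin (t + 2) → V) e =
      (if s(v, w 0) = e then 1 else 0) + edgeVisits w e := by
  have h := Fin.card_filter_univ_succ fun i : Fin (t + 1) =>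
    s((Fin.cons v w : Fin (t + 2) → V) i.castSucc, (Fin.cons v w : Fin (t + 2) → V) i.succ) = e
  refine h.trans ?_
  change (if s(v, w 0) = e then edgeVisits w e + 1 else edgeVisits w e) = _
  split_ifs <;> omega

theorem edgeVisits_zero (w : Fin 1 → V) (e : Sym2 V) : edgeVisits w e = 0 := by
  simp [edgeVisits]

end Walk

/-! ### Expected number of crossings of an edge set -/

section Crossings

variable {V : Type*} [Fintype V] [DecidableEq V] (G : SimpleGraph V) [DecidableRel G.Adj]

/-- Probability that one step of the standard random walk from `v` goes through an edge of `S`. -/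
noncomputable def crossProb (S : Finset (Sym2 V)) (v : V) : ℝ :=
  ∑ u, stepMatrix G v u * if s(v, u) ∈ S then 1 else 0

/-- Expected number of steps through edges of `S`, counted with multiplicity, in a standard random
walk of length `t` from `v`. -/
noncomputable def expCross (S : Finset (Sym2 V)) (t : ℕ) (v : V) : ℝ :=
  walkExp G t v fun w => ∑ e ∈ S, (edgeVisits w e : ℝ)

variable {G}

theorem expCross_zero (S : Finset (Sym2 V)) (v : V) : expCross G S 0 v = 0 := by
  simp [expCross, walkExp_zero, edgeVisits_zero]

theorem expCross_succ (hdeg : ∀ v, 0 < G.degree v) (S : Finset (Sym2 V)) (t : ℕ) (v : V) :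
    expCross G S (t + 1) v =
      crossProb G S v + ∑ u, stepMatrix G v u * expCross G S t u := by
  unfold expCross crossProb
  rw [walkExp_succ, ← Finset.sum_add_distrib]
  refine Finset.sum_congr rfl fun u _ => ?_
  rw [← mul_add]
  congr 1
  rw [← walkExp_const hdeg (if s(v, u) ∈ S then 1 else 0) t u, ← walkExp_add]
  refine walkExp_congr fun w hw => ?_
  simp only [edgeVisits_cons, hw, Nat.cast_add, Finset.sum_add_distrib, Nat.cast_ite,
    Nat.cast_one, Nat.cast_zero, Finset.sum_ite_eq]

theorem expCross_eq_sum (hdeg : ∀ v, 0 < G.degree v) (S : Finset (Sym2 V)) (t : ℕ) (v : V) :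
    expCross G S t v =
      ∑ i ∈ Finset.range t, ∑ x, (stepMatrix G ^ i) v x * crossProb G S x := by
  induction t generalizing v with
  | zero => simp [expCross_zero]
  | succ t ih =>
    rw [expCross_succ hdeg, Finset.sum_range_succ', add_comm]
    congr 1
    · simp only [ih, Finset.mul_sum]
      rw [Finset.sum_comm]
      refine Finset.sum_congr rfl fun i _ => ?_
      rw [Finset.sum_comm]
      refine Finset.sum_congr rfl fun x _ => ?_
      rw [pow_succ', Matrix.mul_apply, Finset.sum_mul]
      exact Finset.sum_congr rfl fun u _ => by ring
    · simp [Matrix.one_apply]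

theorem stepMatrix_pow_nonneg (i : ℕ) (u v : V) : 0 ≤ (stepMatrix G ^ i) u v := by
  induction i generalizing u with
  | zero => rw [pow_zero, Matrix.one_apply]; positivity
  | succ i ih =>
    rw [pow_succ', Matrix.mul_apply]
    exact Finset.sum_nonneg fun x _ => mul_nonneg (stepMatrix_nonneg G _ _) (ih x)

theorem sum_stepMatrix_pow (hdeg : ∀ v, 0 < G.degree v) (i : ℕ) (u : V) :
    ∑ v, (stepMatrix G ^ i) u v = 1 := by
  induction i generalizing u with
  | zero => simp [Matrix.one_apply]
  | succ i ih =>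
    simp only [pow_succ', Matrix.mul_apply]
    rw [Finset.sum_comm]
    simp only [← Finset.mul_sum, ih, mul_one, sum_stepMatrix G (hdeg u)]

/-- Averaging over the position after `i` steps does not increase a uniform upper bound. -/
theorem sum_stepMatrix_pow_mul_le (hdeg : ∀ v, 0 < G.degree v) (i : ℕ) (u : V) {f : V → ℝ} {b : ℝ}
    (hf : ∀ x, f x ≤ b) : ∑ x, (stepMatrix G ^ i) u x * f x ≤ b := by
  calc ∑ x, (stepMatrix G ^ i) u x * f x ≤ ∑ x, (stepMatrix G ^ i) u x * b :=
        Finset.sum_le_sum fun x _ =>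
          mul_le_mul_of_nonneg_left (hf x) (stepMatrix_pow_nonneg i u x)
    _ = b := by rw [← Finset.sum_mul, sum_stepMatrix_pow hdeg, one_mul]

theorem card_filter_mk_eq {e : Sym2 V} (he : ¬ e.IsDiag) :
    (Finset.univ.filter fun p : V × V => s(p.1, p.2) = e).card = 2 := by
  induction e with
  | h a b =>
    have hab : a ≠ b := fun h => he (Sym2.mk_isDiag_iff.2 h)
    have : (Finset.univ.filter fun p : V × V => s(p.1, p.2) = s(a, b)) = {(a, b), (b, a)} := by
      ext ⟨x, y⟩
      simp
    rw [this, Finset.card_pair (by simp [hab])]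

theorem sum_mk_mem {S : Finset (Sym2 V)} (hS : S ⊆ G.edgeFinset) :
    ∑ v, ∑ u, (if s(v, u) ∈ S then 1 else 0 : ℝ) = 2 * S.card := by
  have h : ∀ p : V × V, (if s(p.1, p.2) ∈ S then 1 else 0 : ℝ) =
      ∑ e ∈ S, if s(p.1, p.2) = e then 1 else 0 := fun p => by rw [Finset.sum_ite_eq]
  rw [← Fintype.sum_prod_type' (f := fun v u => (if s(v, u) ∈ S then 1 else 0 : ℝ))]
  simp only [h]
  rw [Finset.sum_comm, Finset.sum_congr rfl fun e he => ?_]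
  rotate_left
  · exact fun _ => 2
  · rw [Finset.sum_boole,
      card_filter_mk_eq (G.not_isDiag_of_mem_edgeSet (SimpleGraph.mem_edgeFinset.1 (hS he)))]
    norm_num
  · rw [Finset.sum_const, nsmul_eq_mul, mul_comm]

theorem stepMatrix_le {D : ℕ} (hD : 1 ≤ D) (hdeg : ∀ v, D ≤ G.degree v) (u v : V) :
    stepMatrix G u v ≤ 1 / D := by
  have : (0 : ℝ) < D := by exact_mod_cast hD
  simp only [stepMatrix, Matrix.of_apply]
  split_ifs
  · exact one_div_le_one_div_of_le this (by exact_mod_cast hdeg u)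
  · positivity

theorem crossProb_nonneg (S : Finset (Sym2 V)) (v : V) : 0 ≤ crossProb G S v :=
  Finset.sum_nonneg fun u _ => mul_nonneg (stepMatrix_nonneg G _ _) (by positivity)

theorem crossProb_le {D : ℕ} (hD : 1 ≤ D) (hdeg : ∀ v, D ≤ G.degree v) (S : Finset (Sym2 V))
    (v : V) : crossProb G S v ≤ S.card / D := by
  have hinj : Function.Injective fun u : V => s(v, u) := fun _ _ h => Sym2.congr_right.1 h
  calc crossProb G S v ≤ ∑ u, 1 / (D : ℝ) * if s(v, u) ∈ S then 1 else 0 :=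
        Finset.sum_le_sum fun u _ =>
          mul_le_mul_of_nonneg_right (stepMatrix_le hD hdeg v u) (by positivity)
    _ = 1 / (D : ℝ) * (Finset.univ.filter fun u => s(v, u) ∈ S).card := by
        rw [← Finset.mul_sum, Finset.sum_boole]
    _ ≤ 1 / (D : ℝ) * S.card := by
        refine mul_le_mul_of_nonneg_left ?_ (by positivity)
        exact_mod_cast Finset.card_le_card_of_injOn (fun u => s(v, u))
          (fun u hu => by simpa using hu) hinj.injOn
    _ = S.card / D := by ring

theorem sum_crossProb_le {D : ℕ} (hD : 1 ≤ D) (hdeg : ∀ v, D ≤ G.degree v)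
    {S : Finset (Sym2 V)} (hS : S ⊆ G.edgeFinset) :
    ∑ v, crossProb G S v ≤ 2 * S.card / D := by
  calc ∑ v, crossProb G S v ≤ ∑ v, ∑ u, 1 / (D : ℝ) * if s(v, u) ∈ S then 1 else 0 :=
        Finset.sum_le_sum fun v _ => Finset.sum_le_sum fun u _ =>
          mul_le_mul_of_nonneg_right (stepMatrix_le hD hdeg v u) (by positivity)
    _ = 2 * S.card / D := by
        simp only [← Finset.mul_sum]
        rw [sum_mk_mem hS]
        ring

theorem sum_stationaryProb_mul_crossProb {S : Finset (Sym2 V)} (hS : S ⊆ G.edgeFinset) :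
    ∑ v, stationaryProb G v * crossProb G S v = S.card / G.edgeFinset.card := by
  have h : ∀ v u : V, stationaryProb G v * (stepMatrix G v u * if s(v, u) ∈ S then 1 else 0) =
      1 / (2 * (G.edgeFinset.card : ℝ)) * if s(v, u) ∈ S then 1 else 0 := by
    intro v u
    rw [← mul_assoc, stationaryProb_mul_stepMatrix]
    split_ifs with h1 h2 h2 <;> try simp
    exact absurd (by simpa using hS h2) h1
  simp only [crossProb, Finset.mul_sum, h]
  simp only [← Finset.mul_sum]
  rw [sum_mk_mem hS, one_div, mul_inv]
  ring

/-- From the stationary law, each of the `t` steps goes through a given edge with probability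
`1 / |E|`. -/
theorem sum_stationaryProb_mul_expCross (hdeg : ∀ v, 0 < G.degree v) {S : Finset (Sym2 V)}
    (hS : S ⊆ G.edgeFinset) (t : ℕ) :
    ∑ v, stationaryProb G v * expCross G S t v = t * (S.card / G.edgeFinset.card) := by
  induction t with
  | zero => simp [expCross_zero]
  | succ t ih =>
    simp only [expCross_succ hdeg, mul_add, Finset.sum_add_distrib]
    rw [sum_stationaryProb_mul_crossProb hS]
    simp only [Finset.mul_sum, ← mul_assoc]
    rw [Finset.sum_comm]
    simp only [← Finset.sum_mul, sum_stationaryProb_mul_stepMatrix]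
    rw [ih]
    push_cast
    ring

theorem card_edgeFinset_le {D : ℕ} {c : ℝ} (hG : IsUniformGraph G D c) :
    2 * (G.edgeFinset.card : ℝ) ≤ c * D * Fintype.card V := by
  have h : (∑ v, (G.degree v : ℝ)) = 2 * (G.edgeFinset.card : ℝ) := by
    exact_mod_cast G.sum_degrees_eq_twice_card_edges
  rw [← h]
  calc ∑ v, (G.degree v : ℝ) ≤ ∑ _v : V, c * D := Finset.sum_le_sum fun v _ => (hG v).2
    _ = c * D * Fintype.card V := by simp [mul_comm]

/-- Once the walk has mixed, each step goes through `S` with probability at most twice the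
stationary one: the mixing accuracy `1 / (2cn)²` is at most `D / (2|E|)`, which is what makes the
error term as small as the main term. -/
theorem sum_stepMatrix_pow_mul_crossProb_le {D T : ℕ} {c : ℝ} (hc : 1 ≤ c) (hD : 1 ≤ D)
    (hG : IsUniformGraph G D c)
    (hT : IsMixingTime G (1 / (2 * c * Fintype.card V) ^ 2) T)
    (hE : 0 < G.edgeFinset.card) {S : Finset (Sym2 V)} (hS : S ⊆ G.edgeFinset) {i : ℕ}
    (hi : T ≤ i) (u : V) :
    ∑ x, (stepMatrix G ^ i) u x * crossProb G S x ≤ 2 * S.card / G.edgeFinset.card := by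
  have hdeg : ∀ v, 0 < G.degree v := fun v => lt_of_lt_of_le hD (hG v).1
  have hn : (1 : ℝ) ≤ Fintype.card V := by
    obtain ⟨e, -⟩ := Finset.card_pos.1 hE
    exact_mod_cast Fintype.card_pos_iff.2 ⟨e.out.1⟩
  have hD' : (1 : ℝ) ≤ D := by exact_mod_cast hD
  have hE' : (0 : ℝ) < G.edgeFinset.card := by exact_mod_cast hE
  have hmix : ∀ v, ∑ x, (stepMatrix G ^ T) v x * crossProb G S x ≤
      2 * S.card / G.edgeFinset.card := by
    intro v
    set n : ℝ := (Fintype.card V : ℝ)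
    set δ : ℝ := 1 / (2 * c * n) ^ 2 with hδ
    have hδ0 : 0 ≤ δ := by positivity
    have hδE : δ * (2 * G.edgeFinset.card) ≤ D := by
      have h2 : c * n ≤ (2 * c * n) ^ 2 := by
        have : 1 ≤ c * n := one_le_mul_of_one_le_of_one_le hc hn
        nlinarith
      have h3 := card_edgeFinset_le hG
      rw [hδ, one_div, inv_mul_le_iff₀ (by positivity)]
      calc 2 * (G.edgeFinset.card : ℝ) ≤ (c * n) * D := by linarith
        _ ≤ _ := mul_le_mul_of_nonneg_right h2 (by positivity)
    calc ∑ x, (stepMatrix G ^ T) v x * crossProb G S x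
        ≤ ∑ x, (stationaryProb G x + δ) * crossProb G S x :=
          Finset.sum_le_sum fun x _ => mul_le_mul_of_nonneg_right
            (by linarith [(abs_le.1 (hT.1 v x)).2]) (crossProb_nonneg S x)
      _ = S.card / G.edgeFinset.card + δ * ∑ x, crossProb G S x := by
          simp only [add_mul, Finset.sum_add_distrib, ← Finset.mul_sum]
          rw [sum_stationaryProb_mul_crossProb hS]
      _ ≤ S.card / G.edgeFinset.card + δ * (2 * S.card / D) := by
          gcongr
          exact sum_crossProb_le hD (fun v => (hG v).1) hS
      _ ≤ S.card / G.edgeFinset.card + S.card / G.edgeFinset.card := by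
          gcongr
          rw [le_div_iff₀ hE', mul_div_assoc', div_mul_eq_mul_div, div_le_iff₀ (by positivity)]
          calc δ * (2 * S.card) * G.edgeFinset.card = S.card * (δ * (2 * G.edgeFinset.card)) := by
                ring
            _ ≤ S.card * D := by gcongr
      _ = _ := by ring
  obtain ⟨j, rfl⟩ := Nat.exists_eq_add_of_le' hi
  have h : ∑ x, (stepMatrix G ^ (j + T)) u x * crossProb G S x =
      ∑ y, (stepMatrix G ^ j) u y * ∑ x, (stepMatrix G ^ T) y x * crossProb G S x := by
    simp only [pow_add, Matrix.mul_apply, Finset.sum_mul, Finset.mul_sum, mul_assoc]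
    rw [Finset.sum_comm]
  rw [h]
  exact sum_stepMatrix_pow_mul_le hdeg j u hmix

/-- The number of steps through `S` from an arbitrary start: the `T` steps before mixing
contribute at most `|S| / D` each, the others at most `2|S| / |E|` each. -/
theorem expCross_le {D T : ℕ} {c : ℝ} (hc : 1 ≤ c) (hD : 1 ≤ D) (hG : IsUniformGraph G D c)
    (hT : IsMixingTime G (1 / (2 * c * Fintype.card V) ^ 2) T)
    (hE : 0 < G.edgeFinset.card) {S : Finset (Sym2 V)} (hS : S ⊆ G.edgeFinset) (t : ℕ) (u : V) :
    expCross G S t u ≤ S.card * (T / D + 2 * t / G.edgeFinset.card) := by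
  have hdeg : ∀ v, 0 < G.degree v := fun v => lt_of_lt_of_le hD (hG v).1
  rw [expCross_eq_sum hdeg]
  calc ∑ i ∈ Finset.range t, ∑ x, (stepMatrix G ^ i) u x * crossProb G S x
      ≤ ∑ i ∈ Finset.range t, ((if i < T then (S.card : ℝ) / D else 0) +
          2 * S.card / G.edgeFinset.card) := by
        refine Finset.sum_le_sum fun i _ => ?_
        split_ifs with hi
        · have := sum_stepMatrix_pow_mul_le hdeg i u (crossProb_le hD (fun v => (hG v).1) S)
          have : (0 : ℝ) ≤ 2 * S.card / G.edgeFinset.card := by positivity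
          linarith
        · rw [zero_add]
          exact sum_stepMatrix_pow_mul_crossProb_le hc hD hG hT hE hS (not_lt.1 hi) u
    _ = ((Finset.range t).filter (· < T)).card * ((S.card : ℝ) / D) +
          t * (2 * S.card / G.edgeFinset.card) := by
        rw [Finset.sum_add_distrib, ← Finset.sum_filter, Finset.sum_const, Finset.sum_const,
          Finset.card_range, nsmul_eq_mul, nsmul_eq_mul]
    _ ≤ T * ((S.card : ℝ) / D) + t * (2 * S.card / G.edgeFinset.card) := by
        gcongr
        calc _ ≤ (Finset.range T).card :=
              Finset.card_le_card fun i hi => by simp at hi ⊢; exact hi.2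
          _ = T := Finset.card_range T
    _ = _ := by ring

end Crossings

/-! ### Visits and revisits -/

section Visits

variable {V : Type*} [Fintype V] [DecidableEq V] {G : SimpleGraph V} [DecidableRel G.Adj]

/-- The set of edges of `S` visited by the trajectory `w`. -/
def visitedEdges (S : Finset (Sym2 V)) {t : ℕ} (w : Fin (t + 1) → V) : Finset (Sym2 V) :=
  S.filter fun e => edgeVisits w e ≠ 0

theorem visitedEdges_zero (S : Finset (Sym2 V)) (w : Fin 1 → V) : visitedEdges S w = ∅ := by
  simp [visitedEdges, edgeVisits_zero]

theorem visitedEdges_cons (S : Finset (Sym2 V)) {t : ℕ} (v : V) (w : Fin (t + 1) → V) :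
    visitedEdges S (Fin.cons v w : Fin (t + 2) → V) =
      S.filter (fun e => s(v, w 0) = e) ∪ visitedEdges S w := by
  ext e
  simp only [visitedEdges, edgeVisits_cons, Finset.mem_filter, Finset.mem_union]
  by_cases h : s(v, w 0) = e
  · simp [h]
    tauto
  · simp [h]

/-- The revisit bound in the form that is proved by induction on the number of steps: `A` is the
set of edges already visited. As soon as the `j`-th edge of `S` is reached, a further visit to `S`
has probability at most the expected number of further crossings of `S`. -/
theorem walkExp_revisit_le (hdeg : ∀ v, 0 < G.degree v) {η : ℝ} {S : Finset (Sym2 V)} (t : ℕ)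
    (hB : ∀ t' ≤ t, ∀ u, expCross G S t' u ≤ η) (j : ℕ) (A : Finset (Sym2 V)) (hA : A.card < j)
    (v : V) :
    walkExp G t v (fun w => if j + 1 ≤ (A ∪ visitedEdges S w).card then 1 else 0) ≤
      η * walkExp G t v (fun w => if j ≤ (A ∪ visitedEdges S w).card then 1 else 0) := by
  induction t generalizing v A with
  | zero =>
    simp only [walkExp_zero, visitedEdges_zero, Finset.union_empty]
    rw [if_neg (by omega), if_neg (by omega), mul_zero]
  | succ t ih =>
    rw [walkExp_succ, walkExp_succ, Finset.mul_sum]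
    refine Finset.sum_le_sum fun u _ => ?_
    rw [mul_left_comm]
    refine mul_le_mul_of_nonneg_left ?_ (stepMatrix_nonneg G v u)
    set A' := A ∪ S.filter (fun e => s(v, u) = e) with hA'
    have hstep : ∀ l : ℕ, walkExp G t u (fun w =>
        if l ≤ (A ∪ visitedEdges S (Fin.cons v w : Fin (t + 2) → V)).card then (1 : ℝ) else 0) =
        walkExp G t u (fun w => if l ≤ (A' ∪ visitedEdges S w).card then 1 else 0) :=
      fun l => walkExp_congr fun w hw => by
        rw [visitedEdges_cons, hw, ← Finset.union_assoc]
    rw [hstep, hstep]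
    have hcard : A'.card ≤ A.card + 1 := by
      refine (Finset.card_union_le _ _).trans (Nat.add_le_add_left ?_ _)
      refine Finset.card_le_one.2 fun x hx y hy => ?_
      rw [← (Finset.mem_filter.1 hx).2, ← (Finset.mem_filter.1 hy).2]
    by_cases hj : A'.card < j
    · exact ih (fun t' ht' => hB t' (by omega)) A' hj u
    · have h1 : walkExp G t u
          (fun w => if j ≤ (A' ∪ visitedEdges S w).card then (1 : ℝ) else 0) = 1 := by
        refine (walkExp_congr fun w _ => if_pos ?_).trans (walkExp_const hdeg 1 t u)
        exact (not_lt.1 hj).trans (Finset.card_le_card Finset.subset_union_left)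
      rw [h1, mul_one]
      refine le_trans (walkExp_mono fun w _ => ?_) (hB t (by omega) u)
      have hnn : ∀ e ∈ S, (0 : ℝ) ≤ edgeVisits w e := fun e _ => Nat.cast_nonneg _
      split_ifs with h
      · have hne : (visitedEdges S w).Nonempty := by
          rw [Finset.nonempty_iff_ne_empty]
          intro h0
          rw [h0, Finset.union_empty] at h
          omega
        obtain ⟨e, he⟩ := hne
        obtain ⟨heS, he0⟩ := Finset.mem_filter.1 he
        refine le_trans ?_ (Finset.single_le_sum hnn heS)
        exact_mod_cast Nat.one_le_iff_ne_zero.2 he0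
      · exact Finset.sum_nonneg hnn

/-- After the first visit to `e`, the walk makes at most `B` further visits on average; so the
expected number of visits is at most `1 + B` times the probability of a visit. -/
theorem expCross_le_mul_walkExp (hdeg : ∀ v, 0 < G.degree v) {B : ℝ} {e : Sym2 V} (t : ℕ)
    (hB : ∀ t' ≤ t, ∀ u, expCross G {e} t' u ≤ B) (v : V) :
    expCross G {e} t v ≤
      (1 + B) * walkExp G t v (fun w => if edgeVisits w e ≠ 0 then 1 else 0) := by
  induction t generalizing v with
  | zero => simp [expCross_zero, walkExp_zero, edgeVisits_zero]
  | succ t ih =>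
    rw [expCross_succ hdeg, walkExp_succ, crossProb, ← Finset.sum_add_distrib, Finset.mul_sum]
    refine Finset.sum_le_sum fun u _ => ?_
    rw [← mul_add, mul_left_comm]
    refine mul_le_mul_of_nonneg_left ?_ (stepMatrix_nonneg G v u)
    by_cases h : s(v, u) = e
    · have h1 : walkExp G t u (fun w =>
          if edgeVisits (Fin.cons v w : Fin (t + 2) → V) e ≠ 0 then (1 : ℝ) else 0) = 1 := by
        refine (walkExp_congr fun w hw => if_pos ?_).trans (walkExp_const hdeg 1 t u)
        rw [edgeVisits_cons, hw, if_pos h]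
        omega
      rw [h1, if_pos (by simpa using h), mul_one]
      linarith [hB t (by omega) u]
    · have h1 : walkExp G t u (fun w =>
          if edgeVisits (Fin.cons v w : Fin (t + 2) → V) e ≠ 0 then (1 : ℝ) else 0) =
          walkExp G t u (fun w => if edgeVisits w e ≠ 0 then 1 else 0) :=
        walkExp_congr fun w hw => by rw [edgeVisits_cons, hw, if_neg h, zero_add]
      rw [h1, if_neg (by simpa using h), zero_add]
      exact ih (fun t' ht' => hB t' (by omega)) u

variable [MeasurableSpace V] [MeasurableSingletonClass V]

theorem visitProb_eq (t j : ℕ) (S : Finset G.edgeSet) :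
    visitProb G t j S = ∑ v, stationaryProb G v * walkExp G t v (fun w =>
      if j ≤ (visitedEdges (S.map (Function.Embedding.subtype _)) w).card then 1 else 0) := by
  unfold visitProb
  rw [goodStartWalk_real]
  simp only [visitedEdges, Finset.filter_map, Finset.card_map]
  rfl

theorem map_subtype_subset_edgeFinset (S : Finset G.edgeSet) :
    S.map (Function.Embedding.subtype _) ⊆ G.edgeFinset := by
  intro e he
  obtain ⟨x, -, rfl⟩ := Finset.mem_map.1 he
  exact SimpleGraph.mem_edgeFinset.2 x.2

/-- The two halves of `η` pay for the crossings before and after the mixing time. -/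
theorem revisitBound_of_le {D T k t : ℕ} {c η : ℝ} (hc : 1 ≤ c) (hD : 1 ≤ D)
    (hG : IsUniformGraph G D c) (hT : IsMixingTime G (1 / (2 * c * Fintype.card V) ^ 2) T)
    (hk : 1 ≤ k) (hkT : (k : ℝ) * T ≤ η / 2 * D)
    (ht : (t : ℝ) ≤ η / 4 * ((G.edgeFinset.card : ℝ) / k)) : RevisitBound G t k η := by
  have hdeg : ∀ v, 0 < G.degree v := fun v => lt_of_lt_of_le hD (hG v).1
  have hD' : (0 : ℝ) < D := by exact_mod_cast hD
  have hk' : (0 : ℝ) < k := by exact_mod_cast hk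
  intro S hS j hj
  rw [visitProb_eq, visitProb_eq, Finset.mul_sum]
  refine Finset.sum_le_sum fun v _ => ?_
  rw [mul_left_comm]
  refine mul_le_mul_of_nonneg_left ?_ (stationaryProb_nonneg G v)
  have hE : 0 < G.edgeFinset.card := by
    obtain ⟨u, hu⟩ := (G.degree_pos_iff_exists_adj v).1 (hdeg v)
    exact Finset.card_pos.2 ⟨s(v, u), by simpa using hu⟩
  have hE' : (0 : ℝ) < G.edgeFinset.card := by exact_mod_cast hE
  have h := walkExp_revisit_le hdeg (η := η) (S := S.map (Function.Embedding.subtype _)) t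
    (fun t' ht' u => ?_) j ∅ (by rw [Finset.card_empty]; omega) v
  · simpa only [Finset.empty_union] using h
  · refine (expCross_le hc hD hG hT hE (map_subtype_subset_edgeFinset S) t' u).trans ?_
    rw [Finset.card_map]
    have htt : (t' : ℝ) ≤ t := by exact_mod_cast ht'
    have hSk : (S.card : ℝ) ≤ k := by exact_mod_cast hS
    calc (S.card : ℝ) * (T / D + 2 * t' / G.edgeFinset.card)
        ≤ k * (T / D + 2 * (η / 4 * ((G.edgeFinset.card : ℝ) / k)) / G.edgeFinset.card) := by
          gcongr
          exact htt.trans ht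
      _ = k * T / D + η / 2 := by field_simp; ring
      _ ≤ η / 2 + η / 2 := by
          have := (div_le_iff₀ hD').2 hkT
          linarith
      _ = η := by ring

/-- Each edge is visited with probability at least of order `1 / (k T)`. -/
theorem le_visit_edge {D T k t : ℕ} {a c : ℝ} (ha : 0 < a) (hc : 1 ≤ c) (hD : 1 ≤ D)
    (hG : IsUniformGraph G D c) (hT : IsMixingTime G (1 / (2 * c * Fintype.card V) ^ 2) T)
    (hT1 : 1 ≤ T) (hk : 1 ≤ k) (ht : a * ((G.edgeFinset.card : ℝ) / k) ≤ t) (e : G.edgeSet) :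
    a / (2 * (1 + a) * (k * T)) ≤ (goodStartWalk G t).real {w | edgeVisits w (e : Sym2 V) ≠ 0} := by
  have hdeg : ∀ v, 0 < G.degree v := fun v => lt_of_lt_of_le hD (hG v).1
  have he : {(e : Sym2 V)} ⊆ G.edgeFinset :=
    Finset.singleton_subset_iff.2 (SimpleGraph.mem_edgeFinset.2 e.2)
  have hE : 0 < G.edgeFinset.card := Finset.card_pos.2 ⟨e, he (Finset.mem_singleton_self _)⟩
  have hE' : (0 : ℝ) < G.edgeFinset.card := by exact_mod_cast hE
  have hD' : (1 : ℝ) ≤ D := by exact_mod_cast hD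
  have hk' : (1 : ℝ) ≤ k := by exact_mod_cast hk
  have hT' : (1 : ℝ) ≤ T := by exact_mod_cast hT1
  set x : ℝ := t / G.edgeFinset.card with hx
  set h : ℝ := (goodStartWalk G t).real {w | edgeVisits w (e : Sym2 V) ≠ 0} with hh
  have hax : a / k ≤ x := by
    rw [hx, le_div_iff₀ hE']
    calc a / k * G.edgeFinset.card = a * ((G.edgeFinset.card : ℝ) / k) := by ring
      _ ≤ t := ht
  have hmain : x ≤ (1 + (T + 2 * x)) * h := by
    rw [hh, goodStartWalk_real, Finset.mul_sum]
    have hst := sum_stationaryProb_mul_expCross hdeg he t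
    rw [Finset.card_singleton, Nat.cast_one, mul_one_div] at hst
    rw [hx, ← hst]
    refine Finset.sum_le_sum fun v _ => ?_
    rw [mul_left_comm]
    refine mul_le_mul_of_nonneg_left ?_ (stationaryProb_nonneg G v)
    rw [hst]
    refine expCross_le_mul_walkExp hdeg t (fun t' ht' u => ?_) v
    refine (expCross_le hc hD hG hT hE he t' u).trans ?_
    rw [Finset.card_singleton, Nat.cast_one, one_mul, mul_div_assoc]
    have : (T : ℝ) / D ≤ T := div_le_self (by positivity) hD'
    gcongr
  have h0 : 0 ≤ h := measureReal_nonneg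
  have hx0 : 0 < x := lt_of_lt_of_le (by positivity) hax
  rw [div_le_iff₀ (by positivity)]
  -- `x / (1 + T + 2 x)` increases with `x`, which is at least `a / k`
  have hkx : a ≤ k * x := by
    rw [div_le_iff₀ (by positivity)] at hax
    linarith
  have h1 : x * (1 - 2 * h) ≤ (1 + T) * h := by linarith
  rcases le_or_gt (1 / 2) h with h2 | h2
  · have : (1 : ℝ) ≤ k * T := one_le_mul_of_one_le_of_one_le hk' hT'
    nlinarith [mul_nonneg h0 ha.le]
  · have h3 : a * (1 - 2 * h) ≤ k * ((1 + T) * h) :=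
      calc a * (1 - 2 * h) ≤ k * x * (1 - 2 * h) :=
            mul_le_mul_of_nonneg_right hkx (by linarith)
        _ = k * (x * (1 - 2 * h)) := by ring
        _ ≤ _ := mul_le_mul_of_nonneg_left h1 (by positivity)
    have h4 : (k : ℝ) * ((1 + T) * h) ≤ 2 * (k * T * h) := by
      have : (k : ℝ) * h ≤ k * h * T := le_mul_of_one_le_right (by positivity) hT'
      nlinarith
    have h5 : a * h ≤ a * h * (k * T) :=
      le_mul_of_one_le_right (by positivity) (one_le_mul_of_one_le_of_one_le hk' hT')
    nlinarith

end Visits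

/-! ### A Chernoff bound for variables with geometric tails -/

section Chernoff

/-- The exponential moment that drives the Chernoff bound: `(1 - η) z / (1 - η z)` is the
generating function of a geometric variable of mean `1 / (1 - η)`, hence for some `z > 1` it stays
below `z ^ r` as soon as `r` exceeds that mean. -/
theorem exists_geometric_lt_rpow {η ε' : ℝ} (hη0 : 0 < η) (hη1 : η < 1) (hε' : 0 < ε') :
    ∃ z : ℝ, 1 < z ∧ η * z < 1 ∧
      z * (1 - η) / (1 - η * z) < z ^ ((1 + ε') / (1 - η)) := by
  have hg : 0 < 1 - η := by linarith
  set r : ℝ := (1 + ε') / (1 - η) with hr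
  have hr1 : 1 ≤ r := by rw [hr, le_div_iff₀ hg]; linarith
  have hrg : r * (1 - η) = 1 + ε' := by rw [hr]; field_simp
  set x : ℝ := ε' / (2 * r * η) with hx
  have hx0 : 0 < x := by positivity
  -- `x` is chosen so that the second-order loss `r η x` uses up half of the slack `ε'`
  have hrx : r * (η * x) = ε' / 2 := by rw [hx]; field_simp
  have hηx : η * x < 1 - η := by
    by_contra h
    have := mul_le_mul_of_nonneg_left (not_lt.1 h) (by linarith : 0 ≤ r)
    linarith
  refine ⟨1 + x, by linarith, by linarith, ?_⟩
  -- by Bernoulli's inequality it suffices to compare with `1 + r x`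
  have hB : 1 + r * x ≤ (1 + x) ^ r := one_add_mul_self_le_rpow_one_add (by linarith) hr1
  refine lt_of_lt_of_le ?_ hB
  rw [div_lt_iff₀ (by linarith)]
  have h1 : (1 + r * x) * (1 - η * (1 + x)) - (1 + x) * (1 - η) =
      x * (r * (1 - η) - 1 - r * (η * x)) := by ring
  rw [hrg, hrx] at h1
  have : 0 < x * (1 + ε' - 1 - ε' / 2) := mul_pos hx0 (by linarith)
  linarith

variable {Ω : Type*} [Finite Ω] [MeasurableSpace Ω] [MeasurableSingletonClass Ω]
  {μ : Measure Ω} [IsProbabilityMeasure μ] {X : Ω → ℕ} {η : ℝ}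

theorem integral_ite_eq_measureReal (p : Ω → Prop) [DecidablePred p] :
    ∫ ω, (if p ω then (1 : ℝ) else 0) ∂μ = μ.real {ω | p ω} := by
  rw [← integral_indicator_one (Set.toFinite _).measurableSet]
  congr 1
  ext ω
  simp [Set.indicator_apply]

theorem tail_le (hη : 0 ≤ η)
    (hX : ∀ j, 1 ≤ j → μ.real {ω | j + 1 ≤ X ω} ≤ η * μ.real {ω | j ≤ X ω}) (j : ℕ) :
    μ.real {ω | j + 1 ≤ X ω} ≤ η ^ j * μ.real {ω | 1 ≤ X ω} := by
  induction j with
  | zero => simp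
  | succ j ih =>
    refine (hX (j + 1) (by omega)).trans ?_
    rw [pow_succ', mul_assoc]
    exact mul_le_mul_of_nonneg_left ih hη

theorem sum_range_ite_lt {R : Type*} [AddCommMonoid R] (f : ℕ → R) {x M : ℕ} (h : x ≤ M) :
    ∑ j ∈ Finset.range M, (if j + 1 ≤ x then f j else 0) = ∑ j ∈ Finset.range x, f j := by
  rw [← Finset.sum_filter]
  congr 1
  ext j
  simp only [Finset.mem_filter, Finset.mem_range]
  omega

theorem geom_sum_le_inv {q : ℝ} (hq0 : 0 ≤ q) (hq1 : q < 1) (M : ℕ) :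
    ∑ j ∈ Finset.range M, q ^ j ≤ 1 / (1 - q) := by
  rw [one_div, ← tsum_geometric_of_lt_one hq0 hq1]
  exact (summable_geometric_of_lt_one hq0 hq1).sum_le_tsum _ fun _ _ => by positivity

theorem integral_le_of_tail (hη0 : 0 ≤ η) (hη1 : η < 1) {M : ℕ} (hM : ∀ ω, X ω ≤ M)
    (hX : ∀ j, 1 ≤ j → μ.real {ω | j + 1 ≤ X ω} ≤ η * μ.real {ω | j ≤ X ω}) :
    ∫ ω, (X ω : ℝ) ∂μ ≤ μ.real {ω | 1 ≤ X ω} / (1 - η) := by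
  have h : ∀ ω, (X ω : ℝ) = ∑ j ∈ Finset.range M, if j + 1 ≤ X ω then (1 : ℝ) else 0 := fun ω => by
    rw [sum_range_ite_lt _ (hM ω)]
    simp
  simp only [h]
  rw [integral_finsetSum _ fun _ _ => Integrable.of_finite]
  calc ∑ j ∈ Finset.range M, ∫ ω, (if j + 1 ≤ X ω then (1 : ℝ) else 0) ∂μ
      ≤ ∑ j ∈ Finset.range M, η ^ j * μ.real {ω | 1 ≤ X ω} :=
        Finset.sum_le_sum fun j _ => by
          rw [integral_ite_eq_measureReal]
          exact tail_le hη0 hX j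
    _ ≤ 1 / (1 - η) * μ.real {ω | 1 ≤ X ω} := by
        rw [← Finset.sum_mul]
        exact mul_le_mul_of_nonneg_right (geom_sum_le_inv hη0 hη1 M) measureReal_nonneg
    _ = _ := by ring

/-- Exponential moment of `X - r 1_{X ≥ 1}` when, given `X ≥ 1`, the tail of `X` is at most
geometric. -/
theorem integral_rpow_le_of_tail (hη0 : 0 ≤ η) {M : ℕ} (hM : ∀ ω, X ω ≤ M)
    (hX : ∀ j, 1 ≤ j → μ.real {ω | j + 1 ≤ X ω} ≤ η * μ.real {ω | j ≤ X ω})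
    {z r : ℝ} (hz : 1 < z) (hηz : η * z < 1) :
    ∫ ω, z ^ ((X ω : ℝ) - if 1 ≤ X ω then r else 0) ∂μ ≤
      1 - (1 - z ^ (-r) * (z * (1 - η) / (1 - η * z))) * μ.real {ω | 1 ≤ X ω} := by
  have hz0 : 0 < z := by linarith
  set y : ℝ := z ^ (-r) with hy
  have hy0 : 0 < y := Real.rpow_pos_of_pos hz0 _
  set p : ℝ := μ.real {ω | 1 ≤ X ω} with hp
  have hp0 : 0 ≤ p := measureReal_nonneg
  -- telescoping of `z ^ X` over the levels `j + 1 ≤ X`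
  have h : ∀ ω, z ^ ((X ω : ℝ) - if 1 ≤ X ω then r else 0) =
      1 + (y - 1) * (if 1 ≤ X ω then 1 else 0) +
        y * ∑ j ∈ Finset.range M, (z - 1) * z ^ j * if j + 1 ≤ X ω then 1 else 0 := by
    intro ω
    simp only [mul_ite, mul_one, mul_zero]
    rw [sum_range_ite_lt _ (hM ω), ← Finset.mul_sum, mul_comm (z - 1), geom_sum_mul]
    split_ifs with h1
    · rw [sub_eq_add_neg, Real.rpow_add hz0, Real.rpow_natCast]
      ring
    · have h0 : X ω = 0 := by omega
      simp [h0]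
  simp only [h]
  rw [integral_add .of_finite .of_finite, integral_add .of_finite .of_finite,
    integral_const_mul, integral_const_mul, integral_finsetSum _ fun _ _ => Integrable.of_finite,
    integral_ite_eq_measureReal]
  simp only [integral_const_mul, integral_ite_eq_measureReal, integral_const, probReal_univ,
    smul_eq_mul, mul_one]
  have hsum : ∑ j ∈ Finset.range M, (z - 1) * z ^ j * μ.real {ω | j + 1 ≤ X ω} ≤
      (z - 1) * (1 / (1 - η * z)) * p := by
    calc ∑ j ∈ Finset.range M, (z - 1) * z ^ j * μ.real {ω | j + 1 ≤ X ω}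
        ≤ ∑ j ∈ Finset.range M, (z - 1) * z ^ j * (η ^ j * p) :=
          Finset.sum_le_sum fun j _ => mul_le_mul_of_nonneg_left (tail_le hη0 hX j)
            (mul_nonneg (by linarith) (by positivity))
      _ = (z - 1) * (∑ j ∈ Finset.range M, (η * z) ^ j) * p := by
          rw [Finset.mul_sum, Finset.sum_mul]
          exact Finset.sum_congr rfl fun j _ => by rw [mul_pow]; ring
      _ ≤ _ := by
          refine mul_le_mul_of_nonneg_right (mul_le_mul_of_nonneg_left ?_ (by linarith)) hp0
          exact geom_sum_le_inv (by positivity) hηz M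
  have hne : 1 - η * z ≠ 0 := by linarith
  have := mul_le_mul_of_nonneg_left hsum hy0.le
  have hid : 1 + (y - 1) * p + y * ((z - 1) * (1 / (1 - η * z)) * p) =
      1 - (1 - y * (z * (1 - η) / (1 - η * z))) * p := by
    have hdiv : z * (1 - η) / (1 - η * z) = 1 + (z - 1) * (1 / (1 - η * z)) := by
      rw [div_eq_iff hne, add_mul, mul_assoc, one_div_mul_cancel hne]
      ring
    rw [hdiv]
    ring
  linarith

/-- For `m` independent copies of `X`, the total is more than `r` times the number of nonzero
copies only with probability exponentially small in `m P(X ≥ 1)`. -/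
theorem measure_pi_sum_gt_le (hη0 : 0 ≤ η) {M : ℕ} (hM : ∀ ω, X ω ≤ M)
    (hX : ∀ j, 1 ≤ j → μ.real {ω | j + 1 ≤ X ω} ≤ η * μ.real {ω | j ≤ X ω})
    {z r : ℝ} (hz : 1 < z) (hηz : η * z < 1) (m : ℕ) :
    (Measure.pi fun _ : Fin m => μ).real
        {W | r * (Finset.univ.filter fun i => 1 ≤ X (W i)).card < ∑ i, (X (W i) : ℝ)} ≤
      Real.exp (-((1 - z ^ (-r) * (z * (1 - η) / (1 - η * z))) *
        μ.real {ω | 1 ≤ X ω} * m)) := by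
  have hz0 : 0 < z := by linarith
  set f : Ω → ℝ := fun ω => z ^ ((X ω : ℝ) - if 1 ≤ X ω then r else 0) with hf
  have hf0 : ∀ ω, 0 < f ω := fun ω => Real.rpow_pos_of_pos hz0 _
  have hI := integral_rpow_le_of_tail (r := r) hη0 hM hX hz hηz
  set q : ℝ := (1 - z ^ (-r) * (z * (1 - η) / (1 - η * z))) * μ.real {ω | 1 ≤ X ω}
  calc _ ≤ (Measure.pi fun _ : Fin m => μ).real {W | 1 ≤ ∏ i, f (W i)} := by
        refine measureReal_mono fun W hW => ?_
        simp only [Set.mem_ofPred_eq, hf] at hW ⊢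
        rw [← Real.rpow_sum_of_pos hz0, Finset.sum_sub_distrib, ← Finset.sum_filter,
          Finset.sum_const, nsmul_eq_mul]
        exact Real.one_le_rpow hz.le (by linarith)
    _ ≤ ∫ W, ∏ i, f (W i) ∂(Measure.pi fun _ : Fin m => μ) := by
        have := mul_meas_ge_le_integral_of_nonneg (μ := Measure.pi fun _ : Fin m => μ)
          (f := fun W => ∏ i, f (W i))
          (Filter.Eventually.of_forall fun W => Finset.prod_nonneg fun i _ => (hf0 (W i)).le)
          Integrable.of_finite 1
        simpa using this
    _ = (∫ ω, f ω ∂μ) ^ m := by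
        rw [integral_fintype_prod_eq_pow, Fintype.card_fin]
    _ ≤ (Real.exp (-q)) ^ m := by
        refine pow_le_pow_left₀ (integral_nonneg fun ω => (hf0 ω).le) (hI.trans ?_) m
        linarith [Real.add_one_le_exp (-q)]
    _ = _ := by
        rw [← Real.exp_nat_mul]
        congr 1
        ring

end Chernoff

/-! ### Expansion -/

section Expander

open Classical in
/-- Number of links leaving `S`, row by row. -/
theorem card_links_eq_sum {M E : Type*} [Fintype M] (A : Matrix M E ℕ) (S : Finset E) :
    ((Finset.univ ×ˢ S).filter fun x : M × E => A x.1 x.2 ≠ 0).card =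
      ∑ i, (S.filter fun e => A i e ≠ 0).card := by
  simp only [Finset.card_filter]
  rw [Finset.sum_product]

theorem IsExpander.congr_support {M E : Type*} [Fintype M] {A B : Matrix M E ℕ} {k : ℕ} {ε : ℝ}
    (hA : IsExpander A k ε) (h : ∀ i e, B i e ≠ 0 ↔ A i e ≠ 0) : IsExpander B k ε := by
  intro S hS
  convert! hA S hS using 4
  · exact Finset.filter_congr fun x _ => h _ _
  · exact exists_congr fun e => and_congr_right fun _ => h _ e

theorem IsRegularizedMatrix.ne_zero_iff {V : Type*} [DecidableEq V] {G : SimpleGraph V} {t m : ℕ}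
    {W : Fin m → Fin (t + 1) → V} {A : Matrix (Fin m) G.edgeSet ℕ}
    (hA : IsRegularizedMatrix G W A) (i : Fin m) (e : G.edgeSet) :
    A i e ≠ 0 ↔ traversalMatrix G W i e ≠ 0 := by
  obtain ⟨u, v, p, hp, hAp⟩ := hA i
  rw [hAp, traversalMatrix, Matrix.of_apply, ← hp.1, ← Nat.pos_iff_ne_zero, List.count_pos_iff]

/-- Number of distinct edges of `S` visited by the trajectory `w`. -/
def visitCount {V : Type*} [DecidableEq V] {G : SimpleGraph V} (S : Finset G.edgeSet) {t : ℕ}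
    (w : Fin (t + 1) → V) : ℕ :=
  (S.filter fun e : G.edgeSet => edgeVisits w (e : Sym2 V) ≠ 0).card

/-- Expansion of the traversal matrix in terms of the numbers of visited edges: they sum to the
number of links leaving `S`, and the walks where they are nonzero are the neighbours of `S`. -/
theorem isExpander_traversalMatrix {V : Type*} [DecidableEq V] {G : SimpleGraph V} {t m k : ℕ}
    {W : Fin m → Fin (t + 1) → V} {r : ℝ} (hr : 0 < r)
    (h : ∀ S : Finset G.edgeSet, S.card ≤ k → S.Nonempty → ∑ i, (visitCount S (W i) : ℝ) ≤
      r * (Finset.univ.filter fun i => 1 ≤ visitCount S (W i)).card) :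
    IsExpander (traversalMatrix G W) k (1 - 1 / r) := by
  intro S hS
  rcases S.eq_empty_or_nonempty with rfl | hne
  · simp
  rw [card_links_eq_sum, Nat.cast_sum, sub_sub_cancel, one_div, inv_mul_le_iff₀ hr]
  have hnbrs : ∀ i, (∃ e ∈ S, traversalMatrix G W i e ≠ 0) ↔ 1 ≤ visitCount S (W i) := fun i => by
    simp [visitCount, traversalMatrix, Finset.one_le_card, Finset.Nonempty]
  convert! h S hS hne using 4
  ext i
  simp only [Finset.mem_filter, hnbrs]

end Expander

section Probability

variable {V : Type*} [Fintype V] [DecidableEq V] {G : SimpleGraph V} [DecidableRel G.Adj]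

/-- A walk of length `0` is far from mixed. -/
theorem one_le_mixingTime {T : ℕ} {c : ℝ} (hc : 1 ≤ c) (hn : 2 ≤ Fintype.card V)
    (hT : IsMixingTime G (1 / (2 * c * Fintype.card V) ^ 2) T) : 1 ≤ T := by
  by_contra h
  obtain rfl : T = 0 := by omega
  obtain ⟨u, v, huv⟩ := Fintype.exists_pair_of_one_lt_card (show 1 < Fintype.card V by omega)
  have h1 := hT.1 u u
  have h2 := hT.1 v u
  have hn' : (2 : ℝ) ≤ Fintype.card V := by exact_mod_cast hn
  have hδ : 1 / (2 * c * Fintype.card V) ^ 2 ≤ (1 / 16 : ℝ) := by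
    refine one_div_le_one_div_of_le (by norm_num) ?_
    have : 4 ≤ 2 * c * Fintype.card V := by nlinarith
    nlinarith
  rw [pow_zero, Matrix.one_apply_eq] at h1
  rw [pow_zero, Matrix.one_apply_ne huv.symm] at h2
  linarith [(abs_le.1 h1).2, (abs_le.1 h2).1]

variable [MeasurableSpace V] [MeasurableSingletonClass V]

/-- The probability of visiting `S` is at least of order `|S| / (k T)`: the expected number of
visited edges of `S` has this order, and the revisit bound makes this expectation comparable with
the probability of visiting `S` at all. -/
theorem le_visitProb_one {D T k t : ℕ} {a c η : ℝ} (ha : 0 < a) (hc : 1 ≤ c) (hη0 : 0 < η)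
    (hη1 : η < 1) (hD : 1 ≤ D) (hG : IsUniformGraph G D c)
    (hT : IsMixingTime G (1 / (2 * c * Fintype.card V) ^ 2) T) (hT1 : 1 ≤ T) (hk : 1 ≤ k)
    [IsProbabilityMeasure (goodStartWalk G t)]
    (ht : a * ((G.edgeFinset.card : ℝ) / k) ≤ t) (hR : RevisitBound G t k η)
    {S : Finset G.edgeSet} (hS : S.card ≤ k) :
    (1 - η) * (S.card * (a / (2 * (1 + a) * (k * T)))) ≤ visitProb G t 1 S := by
  have h := integral_le_of_tail (μ := goodStartWalk G t) (X := visitCount S) hη0.le hη1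
    (fun w => Finset.card_filter_le _ _) (hR S hS)
  have hI : ∫ w, (visitCount S w : ℝ) ∂goodStartWalk G t =
      ∑ e ∈ S, (goodStartWalk G t).real {w | edgeVisits w (e : Sym2 V) ≠ 0} := by
    simp only [visitCount, Finset.card_filter, Nat.cast_sum, Nat.cast_ite, Nat.cast_one,
      Nat.cast_zero]
    rw [integral_finsetSum _ fun _ _ => Integrable.of_finite]
    exact Finset.sum_congr rfl fun e _ => integral_ite_eq_measureReal _
  rw [hI, le_div_iff₀ (by linarith), mul_comm] at h
  refine le_trans (mul_le_mul_of_nonneg_left ?_ (by linarith)) h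
  rw [← nsmul_eq_mul]
  exact Finset.card_nsmul_le_sum _ _ _ fun e _ => le_visit_edge ha hc hD hG hT hT1 hk ht e

/-- The union bound summed over all nonempty edge sets at once. -/
theorem sum_nonempty_pow_card {E : Type*} [Fintype E] [DecidableEq E] (q : ℝ) :
    ∑ S : Finset E, (if S.Nonempty then q ^ S.card else 0) = (1 + q) ^ Fintype.card E - 1 := by
  have h := Fintype.sum_pow_mul_eq_add_pow E q 1
  simp only [one_pow, mul_one] at h
  rw [add_comm, ← h, eq_sub_iff_add_eq, ← Finset.add_sum_erase _ _ (Finset.mem_univ ∅),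
    ← Finset.add_sum_erase _ (fun S : Finset E => q ^ S.card) (Finset.mem_univ ∅)]
  simp only [Finset.not_nonempty_empty, if_false, Finset.card_empty, pow_zero, zero_add]
  rw [add_comm]
  congr 1
  exact Finset.sum_congr rfl fun S hS =>
    if_pos (Finset.nonempty_iff_ne_empty.2 (Finset.ne_of_mem_erase hS))

/-- With `q = n ^ (-3)` and at most `n ^ 2` edges, the union bound `(1 + q) ^ E - 1` tends to `0`. -/
theorem one_add_pow_sub_one_le {n E : ℕ} (hn : 1 ≤ n) (hE : E ≤ n ^ 2) :
    (1 + Real.exp (-(3 * Real.log n))) ^ E - 1 ≤ 2 / n := by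
  have hn' : (1 : ℝ) ≤ n := by exact_mod_cast hn
  have hq : Real.exp (-(3 * Real.log n)) = ((n : ℝ) ^ 3)⁻¹ := by
    rw [Real.exp_neg, mul_comm, Real.exp_mul, Real.exp_log (by linarith)]
    norm_cast
  have hE' : (E : ℝ) ≤ n ^ 2 := by exact_mod_cast hE
  rw [hq]
  have h1 : (1 + ((n : ℝ) ^ 3)⁻¹) ^ E ≤ Real.exp (1 / n) := by
    calc (1 + ((n : ℝ) ^ 3)⁻¹) ^ E ≤ Real.exp (((n : ℝ) ^ 3)⁻¹) ^ E := by
          refine pow_le_pow_left₀ (by positivity) ?_ _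
          linarith [Real.add_one_le_exp (((n : ℝ) ^ 3)⁻¹)]
      _ = Real.exp (E * ((n : ℝ) ^ 3)⁻¹) := by rw [Real.exp_nat_mul]
      _ ≤ Real.exp (n ^ 2 * ((n : ℝ) ^ 3)⁻¹) := by gcongr
      _ = Real.exp (1 / n) := by congr 1; field_simp
  have h2 : |(1 / n : ℝ)| = 1 / n := abs_of_nonneg (by positivity)
  have h3 := Real.abs_exp_sub_one_le (x := (1 / n : ℝ))
    (by rw [h2, div_le_one (by linarith)]; exact hn')
  rw [h2] at h3
  have h4 := (abs_le.1 h3).2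
  have h5 : 2 * (1 / n : ℝ) = 2 / n := by ring
  linarith

/-- Union bound over the nonempty edge sets `S` with at most `k` edges: each one fails to expand
with probability at most `n ^ (-3 |S|)`. -/
theorem goodStartWalks_isExpander {D T k t m : ℕ} {a c η z r : ℝ} (ha : 0 < a) (hc : 1 ≤ c)
    (hη0 : 0 < η) (hη1 : η < 1) (hz : 1 < z) (hηz : η * z < 1) (hr : 0 < r)
    (hρ : 0 < 1 - z ^ (-r) * (z * (1 - η) / (1 - η * z)))
    (hn : 2 ≤ Fintype.card V) (hD : 1 ≤ D) (hG : IsUniformGraph G D c)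
    (hT : IsMixingTime G (1 / (2 * c * Fintype.card V) ^ 2) T) (hk : 1 ≤ k)
    (ht : a * ((G.edgeFinset.card : ℝ) / k) ≤ t) (hR : RevisitBound G t k η)
    (hm : 6 * (1 + a) / ((1 - z ^ (-r) * (z * (1 - η) / (1 - η * z))) * (1 - η) * a) *
      (T * k * Real.log (Fintype.card V)) ≤ m) :
    1 - 2 / (Fintype.card V : ℝ) ≤ (goodStartWalks G t m).real
      {W | IsExpander (traversalMatrix G W) k (1 - 1 / r) ∧
        ∀ A : Matrix (Fin m) G.edgeSet ℕ, IsRegularizedMatrix G W A →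
          IsExpander A k (1 - 1 / r)} := by
  have hT1 := one_le_mixingTime hc hn hT
  have hdeg : ∀ v, 0 < G.degree v := fun v => lt_of_lt_of_le hD (hG v).1
  have hE : 0 < G.edgeFinset.card := by
    obtain ⟨v⟩ := Fintype.card_pos_iff.1 (show 0 < Fintype.card V by omega)
    obtain ⟨u, hu⟩ := (G.degree_pos_iff_exists_adj v).1 (hdeg v)
    exact Finset.card_pos.2 ⟨s(v, u), by simpa using hu⟩
  have : IsProbabilityMeasure (goodStartWalk G t) :=
    isProbabilityMeasure_goodStartWalk hdeg hE t
  have : IsProbabilityMeasure (goodStartWalks G t m) := by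
    unfold goodStartWalks; infer_instance
  set ρ : ℝ := 1 - z ^ (-r) * (z * (1 - η) / (1 - η * z)) with hρdef
  set q : ℝ := Real.exp (-(3 * Real.log (Fintype.card V))) with hq
  -- the walks for which the edge set `S` violates the expansion inequality
  set bad : Finset G.edgeSet → Set (Fin m → Fin (t + 1) → V) := fun S =>
    {W | (S.card ≤ k ∧ S.Nonempty) ∧
      r * (Finset.univ.filter fun i => 1 ≤ visitCount S (W i)).card <
        ∑ i, (visitCount S (W i) : ℝ)} with hbad
  have hT' : (1 : ℝ) ≤ T := by exact_mod_cast hT1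
  have hk' : (1 : ℝ) ≤ k := by exact_mod_cast hk
  have hη' : 0 < 1 - η := by linarith
  have hbad_le : ∀ S, (goodStartWalks G t m).real (bad S) ≤
      if S.Nonempty then q ^ S.card else 0 := by
    intro S
    by_cases hS : S.card ≤ k ∧ S.Nonempty
    · rw [if_pos hS.2]
      have hch := measure_pi_sum_gt_le (μ := goodStartWalk G t) (X := visitCount S) (r := r)
        hη0.le (fun w => Finset.card_filter_le _ _) (hR S hS.1) hz hηz m
      have hset : bad S = {W | r * (Finset.univ.filter fun i => 1 ≤ visitCount S (W i)).card <
          ∑ i, (visitCount S (W i) : ℝ)} := by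
        ext W
        exact and_iff_right hS
      rw [hset]
      refine hch.trans ?_
      rw [hq, ← Real.exp_nat_mul]
      refine Real.exp_le_exp.2 ?_
      have hp := le_visitProb_one ha hc hη0 hη1 hD hG hT hT1 hk ht hR hS.1
      rw [mul_neg]
      refine neg_le_neg ?_
      change _ ≤ ρ * visitProb G t 1 S * m
      -- the constant `6 (1 + a) / (ρ (1 - η) a)` makes this an identity
      calc (S.card : ℝ) * (3 * Real.log (Fintype.card V))
          = ρ * ((1 - η) * (S.card * (a / (2 * (1 + a) * (k * T))))) *
            (6 * (1 + a) / (ρ * (1 - η) * a) * (T * k * Real.log (Fintype.card V))) := by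
            field_simp
            ring
        _ ≤ ρ * visitProb G t 1 S * m :=
            mul_le_mul (mul_le_mul_of_nonneg_left hp hρ.le) hm (by positivity)
              (mul_nonneg hρ.le measureReal_nonneg)
    · have : bad S = ∅ := by
        ext W
        simp only [hbad, Set.mem_ofPred_eq, hS, false_and, Set.mem_empty_iff_false]
      rw [this, measureReal_empty]
      positivity
  have hsub : (⋃ S, bad S)ᶜ ⊆ {W | IsExpander (traversalMatrix G W) k (1 - 1 / r) ∧
      ∀ A : Matrix (Fin m) G.edgeSet ℕ, IsRegularizedMatrix G W A →
        IsExpander A k (1 - 1 / r)} := by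
    intro W hW
    have hexp : IsExpander (traversalMatrix G W) k (1 - 1 / r) :=
      isExpander_traversalMatrix hr fun S hS hne => not_lt.1 fun hlt =>
        hW (Set.mem_iUnion.2 ⟨S, ⟨hS, hne⟩, hlt⟩)
    exact ⟨hexp, fun A hA => hexp.congr_support fun i e => hA.ne_zero_iff i e⟩
  have hbound : (goodStartWalks G t m).real (⋃ S, bad S) ≤ 2 / (Fintype.card V : ℝ) := by
    calc _ ≤ ∑ S, (goodStartWalks G t m).real (bad S) := measureReal_iUnion_fintype_le _
      _ ≤ ∑ S : Finset G.edgeSet, (if S.Nonempty then q ^ S.card else 0) :=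
          Finset.sum_le_sum fun S _ => hbad_le S
      _ = (1 + q) ^ Fintype.card G.edgeSet - 1 := sum_nonempty_pow_card q
      _ ≤ _ := by
          refine one_add_pow_sub_one_le (by omega) ?_
          rw [← SimpleGraph.edgeFinset_card]
          exact G.card_edgeFinset_le_card_choose_two.trans (Nat.choose_le_pow _ _)
  calc 1 - 2 / (Fintype.card V : ℝ) ≤ 1 - (goodStartWalks G t m).real (⋃ S, bad S) := by linarith
    _ = (goodStartWalks G t m).real (⋃ S, bad S)ᶜ :=
        (probReal_compl_eq_one_sub (Set.toFinite _).measurableSet).symm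
    _ ≤ _ := measureReal_mono hsub

end Probability

theorem mainTheorem3 (c η ε' : ℝ) (hc : 1 ≤ c) (hη0 : 0 < η) (hη1 : η < 1) (hε' : 0 < ε') :
    (∃ α κ : ℝ, 0 < α ∧ 0 < κ ∧
      ∀ (n : ℕ) (G : SimpleGraph (Fin n)) [DecidableRel G.Adj] (D T k t : ℕ),
        1 ≤ D → IsUniformGraph G D c → IsMixingTime G (1 / (2 * c * n) ^ 2) T →
        1 ≤ k → (k : ℝ) * T ≤ κ * D →
        (t : ℝ) ≤ α * ((G.edgeFinset.card : ℝ) / k) →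
        RevisitBound G t k η) ∧
    (∀ a : ℝ, 0 < a → ∃ β : ℝ, 0 < β ∧ ∀ ϑ : ℝ, 0 < ϑ → ∃ N : ℕ,
      ∀ (n : ℕ) (G : SimpleGraph (Fin n)) [DecidableRel G.Adj] (D T k t m : ℕ),
        N ≤ n → 1 ≤ D → IsUniformGraph G D c → IsMixingTime G (1 / (2 * c * n) ^ 2) T →
        1 ≤ k → a * ((G.edgeFinset.card : ℝ) / k) ≤ t →
        RevisitBound G t k η →
        β * (T * k * Real.log n) ≤ m →
        1 - ϑ ≤ (goodStartWalks G t m).real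
          {W | IsExpander (traversalMatrix G W) k (1 - (1 - η) / (1 + ε')) ∧
            ∀ A : Matrix (Fin m) G.edgeSet ℕ, IsRegularizedMatrix G W A →
              IsExpander A k (1 - (1 - η) / (1 + ε'))}) := by
  constructor
  · refine ⟨η / 4, η / 2, by positivity, by positivity, ?_⟩
    intro n G _ D T k t hD hG hT hk hkT ht
    exact revisitBound_of_le hc hD hG (by rwa [Fintype.card_fin]) hk hkT ht
  · intro a ha
    obtain ⟨z, hz, hηz, hzr⟩ := exists_geometric_lt_rpow hη0 hη1 hε'
    have hη' : 0 < 1 - η := by linarith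
    have hr : 1 - (1 - η) / (1 + ε') = 1 - 1 / ((1 + ε') / (1 - η)) := by rw [one_div_div]
    set r : ℝ := (1 + ε') / (1 - η)
    have hr0 : 0 < r := by positivity
    have hρ : 0 < 1 - z ^ (-r) * (z * (1 - η) / (1 - η * z)) := by
      rw [sub_pos, Real.rpow_neg (by linarith), inv_mul_lt_iff₀ (by positivity), mul_one]
      exact hzr
    refine ⟨6 * (1 + a) / ((1 - z ^ (-r) * (z * (1 - η) / (1 - η * z))) * (1 - η) * a),
      by positivity, fun ϑ hϑ => ⟨⌈2 / ϑ⌉₊ + 2, ?_⟩⟩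
    intro n G _ D T k t m hN hD hG hT hk ht hR hm
    have h := goodStartWalks_isExpander (m := m) ha hc hη0 hη1 hz hηz hr0 hρ
      (by rw [Fintype.card_fin]; omega) hD hG (by rwa [Fintype.card_fin]) hk ht hR
      (by rwa [Fintype.card_fin])
    rw [Fintype.card_fin] at h
    rw [hr]
    refine le_trans ?_ h
    have hnϑ : 2 / ϑ ≤ n := (Nat.le_ceil _).trans (by exact_mod_cast (by omega : ⌈2 / ϑ⌉₊ ≤ n))
    have hn0 : (0 : ℝ) < n := lt_of_lt_of_le (by positivity) hnϑ
    rw [div_le_iff₀ hϑ] at hnϑ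
    have : 2 / (n : ℝ) ≤ ϑ := by
      rw [div_le_iff₀ hn0]
      linarith
    linarith
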